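/- Let $T\subseteq[0,\infty)$ be closed under addition with $1\in T$ (for example $T=\{1,2,3,\dots\}$, $T=\{\tfrac nN: n\ge 1\}$ for an integer $N\ge1$, or $T=[0,\infty)$), and let $\{\mu_t\}_{t\in T}$ be probability measures on $\mathbb{R}$ all of whose moments are finite. A probability measure $\mu$ is called a spectral measure of a tridiagonal matrix $M=(M_{ij})_{i,j\ge0}$ if $\int x^m\,d\mu(x)=(M^m)_{00}$ for all $m\ge 0$. It has Jacobi parameters $\{\beta_n,\gamma_n\}_{n\ge0}$ if the monic polynomials defined by $P_{-1}=0$, $P_0=1$, $xP_n=P_{n+1}+\beta_nP_n+\gamma_{n-1}P_{n-1}$ are pairwise orthogonal with respect to $\mu$ (if some $\gamma_n=0$, this condition does not depend on the terms after the first such $\gamma_n$). Then the following are equivalent. (i) $\{\mu_t\}$ is a convolution semigroup, that is, $\mu_{s+t}=\mu_s*\mu_t$ for all $s,t\in T$, and there are real sequences $\{\alpha_n,\beta_n,\gamma_n,a_n,b_n,c_n\}_{n\ge0}$ such that, for every $t\in T$, $\mu_t$ is a spectral measure of the tridiagonal matrix $$t\begin{pmatrix}\beta_0&\gamma_0&0&\cdots\\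 \alpha_0&\beta_1&\gamma_1&\cdots\\ 0&\alpha_1&\beta_2&\cdots\\ \vdots&\vdots&\vdots&\ddots\end{pmatrix}+\begin{pmatrix}b_0&c_0&0&\cdots\\ a_0&b_1&c_1&\cdots\\ 0&a_1&b_2&\cdots\\ \vdots&\vdots&\vdots&\ddots\end{pmatrix}.$$ (ii) $\{\mu_t\}$ is a Meixner family: there are real numbers $\beta_0,\gamma_0,b,c$ with $\gamma_0\ge0$, and either $c\ge0$, or $c=-\gamma_0/N$ for an integer $N\ge1$ with $T\subseteq\{\tfrac nN:n\ge0 \text{ an integer}\}$, such that for every $t\in T$ the measure $\mu_t$ has Jacobi parameters $$\beta_n(t)=nb+\beta_0t,\qquad \gamma_n(t)=(n+1)(nc+\gamma_0t),\qquad n\ge0.$$ -/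

import Mathlib

open MeasureTheory Polynomial

noncomputable section

/-- All moments of `μ` are finite. -/
def HasFiniteMoments (μ : Measure ℝ) : Prop :=
  ∀ m : ℕ, Integrable (fun x : ℝ => x ^ m) μ

/-- The infinite tridiagonal matrix with subdiagonal `a 0, a 1, …`, diagonal `b 0, b 1, …` and
superdiagonal `c 0, c 1, …`. -/
def tridiagonal (a b c : ℕ → ℝ) : Matrix ℕ ℕ ℝ := fun i j =>
  if j = i then b i else if j = i + 1 then c i else if i = j + 1 then a j else 0

/-- The entry at `(i, j)` of the power `M ^ m` of an infinite matrix with finitely supported rows,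
by `M ^ (m + 1) = M * M ^ m`. -/
def powEntry (M : Matrix ℕ ℕ ℝ) : ℕ → ℕ → ℕ → ℝ
  | 0, i, j => if i = j then 1 else 0
  | m + 1, i, j => ∑ᶠ k, M i k * powEntry M m k j

/-- `μ` is a spectral measure of the tridiagonal matrix `M` (at the first basis vector `e₀`):
its moments are the vacuum expectations `⟨e₀, M ^ m e₀⟩`. -/
def IsSpectralMeasure (μ : Measure ℝ) (M : Matrix ℕ ℕ ℝ) : Prop :=
  HasFiniteMoments μ ∧ ∀ m : ℕ, ∫ x, x ^ m ∂μ = powEntry M m 0 0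

/-- The monic polynomials with `P 0 = 1` and
`x P m = P (m + 1) + β m * P m + γ (m - 1) * P (m - 1)`, where `P (-1) = 0`. -/
def jacobiPoly (β γ : ℕ → ℝ) : ℕ → ℝ[X]
  | 0 => 1
  | 1 => X - C (β 0)
  | n + 2 => (X - C (β (n + 1))) * jacobiPoly β γ (n + 1) - C (γ n) * jacobiPoly β γ n

/-- `μ` has Jacobi parameters `β, γ`: the monic polynomials of the recurrence are orthogonal with
respect to `μ`. Orthogonality gives `∫ (P (n + 1))² = γ n * ∫ (P n)²`, so that `γ n > 0` as long as
`n + 1 < |supp μ|`, and `γ n = 0` if `n + 1 = |supp μ|`. From there on all `P m` vanish `μ`-almost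
everywhere, whatever the later parameters are: the terms after the first `γ n = 0` are
disregarded. -/
def HasJacobiParameters (μ : Measure ℝ) (β γ : ℕ → ℝ) : Prop :=
  HasFiniteMoments μ ∧ ∀ m n : ℕ, m ≠ n →
    ∫ x, (jacobiPoly β γ m).eval x * (jacobiPoly β γ n).eval x ∂μ = 0

/-- `{μ t : t ∈ T}` is a convolution semigroup. -/
def IsConvolutionSemigroup (T : AddSubsemigroup ℝ) (μ : ℝ → Measure ℝ) : Prop :=
  ∀ s ∈ T, ∀ t ∈ T, μ (s + t) = (μ s).conv (μ t)

/-- `{μ t : t ∈ T}` is a Meixner family: for some `β₀, γ₀, b, c` with `γ₀ ≥ 0`, the measure `μ t` has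
Jacobi parameters `β n = n b + β₀ t` and `γ n = (n + 1) (n c + γ₀ t)`. Here either `c ≥ 0`, or
`c = -γ₀ / N` for a positive integer `N` and `T` consists of multiples `n / N`. -/
def IsMeixnerFamily (T : AddSubsemigroup ℝ) (μ : ℝ → Measure ℝ) : Prop :=
  ∃ β₀ γ₀ b c : ℝ, 0 ≤ γ₀ ∧
    (0 ≤ c ∨ ∃ N : ℕ, 1 ≤ N ∧ c = -γ₀ / (N : ℝ) ∧ ∀ t ∈ T, ∃ n : ℕ, t = (n : ℝ) / (N : ℝ)) ∧
    ∀ t ∈ T, HasJacobiParameters (μ t)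
      (fun n => (n : ℝ) * b + β₀ * t)
      (fun n => ((n : ℝ) + 1) * ((n : ℝ) * c + γ₀ * t))

end

/-! The moments of a tridiagonal matrix depend only on its diagonal and on the products of opposite
off-diagonal entries. Under (i) the moments of `μ t` are thus those of Jacobi parameters `P i`, `Q
i` that are polynomials in `t`.

Rigidity (`exists_meixner_of_convolvesMoments`): compare with the Meixner parameters having the same
first two diagonal and off-diagonal values at `t = 1`. Both moment sequences satisfy the binomial
convolution identity, so at the first order where they may differ the difference is `t * d`. It is
also `∏ i < n, Q' i` times the difference of the next parameters, where `Q'` is the Meixner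
off-diagonal. If `γ₀ ≠ 0` that product has degree `n`, so for `n ≥ 2` the difference must vanish;
for `n ≤ 1` it vanishes by the choice of constants. If `γ₀ = 0` the moments are those of point
masses. The restriction on `c` comes from `0 ≤ ∫ (P n)² = ∏ i < n, γ i`.

Conversely, the exponential generating functions of Meixner coefficients multiply
(`jacobiSeries_meixner_mul`), which gives the convolution identity for moments. The bound `A ^ m *
m!` makes the measure unique (`measure_ext_of_moments`). -/

noncomputable section

/-! ### Moments of tridiagonal matrices -/

/-- The coefficients of `X ^ m` in the polynomials `jacobiPoly B G`. -/
def jacobiCoeff (B G : ℕ → ℝ) : ℕ → ℕ → ℝ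
  | 0, k => if k = 0 then 1 else 0
  | m + 1, 0 => B 0 * jacobiCoeff B G m 0 + G 0 * jacobiCoeff B G m 1
  | m + 1, k + 1 => jacobiCoeff B G m k + B (k + 1) * jacobiCoeff B G m (k + 1)
      + G (k + 1) * jacobiCoeff B G m (k + 2)

lemma jacobiCoeff_eq_zero_of_lt (B G : ℕ → ℝ) :
    ∀ m k : ℕ, m < k → jacobiCoeff B G m k = 0
  | 0, k, h => by simp [jacobiCoeff]; omega
  | m + 1, 0, h => by omega
  | m + 1, k + 1, h => by
    simp [jacobiCoeff, jacobiCoeff_eq_zero_of_lt B G m k (by omega),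
      jacobiCoeff_eq_zero_of_lt B G m (k + 1) (by omega),
      jacobiCoeff_eq_zero_of_lt B G m (k + 2) (by omega)]

lemma jacobiCoeff_self (B G : ℕ → ℝ) : ∀ m : ℕ, jacobiCoeff B G m m = 1
  | 0 => by simp [jacobiCoeff]
  | m + 1 => by
    simp [jacobiCoeff, jacobiCoeff_self B G m, jacobiCoeff_eq_zero_of_lt]

lemma smul_tridiagonal_add_tridiagonal (t : ℝ) (α β γ a b c : ℕ → ℝ) :
    t • tridiagonal α β γ + tridiagonal a b c =
      tridiagonal (fun n => t * α n + a n) (fun n => t * β n + b n) (fun n => t * γ n + c n) := by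
  ext i j
  simp only [tridiagonal, Matrix.add_apply, Matrix.smul_apply, smul_eq_mul]
  split_ifs <;> simp

lemma finsum_tridiagonal_zero_mul (a b c v : ℕ → ℝ) :
    ∑ᶠ k, tridiagonal a b c 0 k * v k = b 0 * v 0 + c 0 * v 1 := by
  rw [finsum_eq_sum_of_support_subset (s := {0, 1})]
  · simp [tridiagonal]
  · intro k hk
    simp only [Function.mem_support, tridiagonal] at hk
    simp only [Finset.coe_insert, Finset.coe_singleton, Set.mem_insert_iff, Set.mem_singleton_iff]
    by_contra! h
    apply hk
    rw [if_neg (by omega), if_neg (by omega), if_neg (by omega), zero_mul]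

lemma finsum_tridiagonal_succ_mul (a b c v : ℕ → ℝ) (i : ℕ) :
    ∑ᶠ k, tridiagonal a b c (i + 1) k * v k =
      a i * v i + b (i + 1) * v (i + 1) + c (i + 1) * v (i + 2) := by
  rw [finsum_eq_sum_of_support_subset (s := {i, i + 1, i + 2})]
  · simp [tridiagonal, add_assoc]
  · intro k hk
    simp only [Function.mem_support, tridiagonal] at hk
    simp only [Finset.coe_insert, Finset.coe_singleton, Set.mem_insert_iff, Set.mem_singleton_iff]
    by_contra! h
    apply hk
    rw [if_neg (by omega), if_neg (by omega), if_neg (by omega), zero_mul]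

/-- The first column of `M ^ m` obeys the recurrence of `jacobiCoeff` after rescaling row `k` by the
product of the subdiagonal. Nothing is divided, so vanishing entries are allowed. -/
lemma powEntry_tridiagonal (a b c : ℕ → ℝ) : ∀ m k : ℕ,
    powEntry (tridiagonal a b c) m k 0 =
      (∏ i ∈ Finset.range k, a i) * jacobiCoeff b (fun i => a i * c i) m k
  | 0, k => by rcases k with _ | k <;> simp [powEntry, jacobiCoeff]
  | m + 1, 0 => by
    rw [powEntry, finsum_tridiagonal_zero_mul, powEntry_tridiagonal a b c m 0,
      powEntry_tridiagonal a b c m 1]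
    simp [jacobiCoeff]
    ring
  | m + 1, k + 1 => by
    rw [powEntry, finsum_tridiagonal_succ_mul, powEntry_tridiagonal a b c m k,
      powEntry_tridiagonal a b c m (k + 1), powEntry_tridiagonal a b c m (k + 2)]
    simp only [jacobiCoeff, Finset.prod_range_succ]
    ring

lemma powEntry_tridiagonal_zero (a b c : ℕ → ℝ) (m : ℕ) :
    powEntry (tridiagonal a b c) m 0 0 = jacobiCoeff b (fun i => a i * c i) m 0 := by
  simp [powEntry_tridiagonal]

/-! ### Formal orthogonality for a linear functional -/

lemma X_mul_jacobiPoly_zero (B G : ℕ → ℝ) :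
    X * jacobiPoly B G 0 = jacobiPoly B G 1 + C (B 0) * jacobiPoly B G 0 := by
  simp [jacobiPoly]

lemma X_mul_jacobiPoly_succ (B G : ℕ → ℝ) (n : ℕ) :
    X * jacobiPoly B G (n + 1) = jacobiPoly B G (n + 2) + C (B (n + 1)) * jacobiPoly B G (n + 1)
      + C (G n) * jacobiPoly B G n := by
  rw [jacobiPoly.eq_3]
  ring

lemma X_pow_eq_sum_jacobiPoly (B G : ℕ → ℝ) (m : ℕ) :
    (X : ℝ[X]) ^ m =
      ∑ k ∈ Finset.range (m + 1), C (jacobiCoeff B G m k) * jacobiPoly B G k := by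
  induction m with
  | zero => simp [jacobiCoeff, jacobiPoly]
  | succ m ih =>
    have hext : (X : ℝ[X]) ^ m =
        ∑ k ∈ Finset.range (m + 3), C (jacobiCoeff B G m k) * jacobiPoly B G k := by
      rw [Finset.sum_range_succ, Finset.sum_range_succ, ← ih]
      simp [jacobiCoeff_eq_zero_of_lt]
    -- Truncating the sum at `N` leaves two boundary terms; at `N = m` one is the new leading term
    -- and the other vanishes.
    have key : ∀ N : ℕ, X * ∑ k ∈ Finset.range (N + 1), C (jacobiCoeff B G m k) * jacobiPoly B G k
        = ∑ k ∈ Finset.range (N + 1), C (jacobiCoeff B G (m + 1) k) * jacobiPoly B G k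
          + C (jacobiCoeff B G m N) * jacobiPoly B G (N + 1)
          - C (G N * jacobiCoeff B G m (N + 1)) * jacobiPoly B G N := by
      intro N
      induction N with
      | zero =>
        simp only [zero_add, Finset.sum_range_one, jacobiCoeff, jacobiPoly, map_add, map_mul]
        ring
      | succ N ihN =>
        rw [Finset.sum_range_succ, mul_add, ihN, Finset.sum_range_succ _ (N + 1),
          mul_left_comm, X_mul_jacobiPoly_succ]
        simp only [jacobiCoeff, map_add, map_mul]
        ring
    rw [pow_succ', ih, key, jacobiCoeff_eq_zero_of_lt B G m (m + 1) (by omega),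
      Finset.sum_range_succ _ (m + 1), jacobiCoeff_self, jacobiCoeff_self]
    simp

/-- A functional has moments `jacobiCoeff B G m 0` iff it annihilates the polynomials
`jacobiPoly B G n`, `n ≥ 1`. -/
lemma moments_eq_jacobiCoeff_iff (L : ℝ[X] →ₗ[ℝ] ℝ) (h1 : L 1 = 1) (B G : ℕ → ℝ) :
    (∀ m, L (X ^ m) = jacobiCoeff B G m 0) ↔ ∀ n, L (jacobiPoly B G (n + 1)) = 0 := by
  have expand : ∀ m, L (X ^ (m + 1)) = jacobiCoeff B G (m + 1) 0 +
      ∑ k ∈ Finset.range (m + 1), jacobiCoeff B G (m + 1) (k + 1) * L (jacobiPoly B G (k + 1)) := by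
    intro m
    rw [X_pow_eq_sum_jacobiPoly B G, map_sum, Finset.sum_range_succ', add_comm]
    simp only [← smul_eq_C_mul, map_smul, smul_eq_mul]
    simp only [jacobiPoly, h1, mul_one]
  constructor
  · intro h n
    induction n using Nat.strong_induction_on with
    | _ n ih =>
      have := expand n
      rw [h, Finset.sum_range_succ, jacobiCoeff_self, Finset.sum_eq_zero] at this
      · linarith
      · intro k hk
        rw [ih k (Finset.mem_range.1 hk), mul_zero]
  · intro h m
    rcases m with _ | m
    · simp [jacobiCoeff, h1]
    · rw [expand, Finset.sum_eq_zero, add_zero]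
      intro k _
      rw [h, mul_zero]

/-- Moving a factor `X` from the left polynomial to the right one lowers the smaller index, until it
reaches `P 0 = 1`. This is purely algebraic: no sign of `G` is needed. -/
lemma apply_jacobiPoly_mul_of_lt {L : ℝ[X] →ₗ[ℝ] ℝ} {B G : ℕ → ℝ}
    (hL : ∀ n, L (jacobiPoly B G (n + 1)) = 0) :
    ∀ m n : ℕ, m < n → L (jacobiPoly B G m * jacobiPoly B G n) = 0
  | 0, n, h => by
    obtain ⟨n, rfl⟩ := Nat.exists_eq_succ_of_ne_zero h.ne'
    simpa [jacobiPoly] using hL n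
  | 1, n, h => by
    obtain ⟨n, rfl⟩ : ∃ k, n = k + 2 := ⟨n - 2, by omega⟩
    have : jacobiPoly B G 1 * jacobiPoly B G (n + 2) = jacobiPoly B G (n + 3)
        + (B (n + 2) - B 0) • jacobiPoly B G (n + 2) + G (n + 1) • jacobiPoly B G (n + 1) := by
      have h1 := X_mul_jacobiPoly_succ B G (n + 1)
      simp only [smul_eq_C_mul, map_sub]
      rw [jacobiPoly.eq_2, sub_mul]
      linear_combination h1
    simp [this, hL]
  | m + 2, n, h => by
    obtain ⟨n, rfl⟩ : ∃ k, n = k + 1 := ⟨n - 1, by omega⟩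
    have : jacobiPoly B G (m + 2) * jacobiPoly B G (n + 1) =
        jacobiPoly B G (m + 1) * jacobiPoly B G (n + 2)
        + (B (n + 1) - B (m + 1)) • (jacobiPoly B G (m + 1) * jacobiPoly B G (n + 1))
        + G n • (jacobiPoly B G (m + 1) * jacobiPoly B G n)
        - G m • (jacobiPoly B G m * jacobiPoly B G (n + 1)) := by
      have h1 := X_mul_jacobiPoly_succ B G n
      have h2 := X_mul_jacobiPoly_succ B G m
      simp only [smul_eq_C_mul, map_sub]
      linear_combination jacobiPoly B G (m + 1) * h1 - jacobiPoly B G (n + 1) * h2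
    simp [this, apply_jacobiPoly_mul_of_lt hL m (n + 1) (by omega),
      apply_jacobiPoly_mul_of_lt hL (m + 1) n (by omega),
      apply_jacobiPoly_mul_of_lt hL (m + 1) (n + 1) (by omega),
      apply_jacobiPoly_mul_of_lt hL (m + 1) (n + 2) (by omega)]

lemma apply_jacobiPoly_mul_of_ne {L : ℝ[X] →ₗ[ℝ] ℝ} {B G : ℕ → ℝ}
    (hL : ∀ n, L (jacobiPoly B G (n + 1)) = 0) {m n : ℕ} (h : m ≠ n) :
    L (jacobiPoly B G m * jacobiPoly B G n) = 0 := by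
  rcases h.lt_or_gt with h | h
  · exact apply_jacobiPoly_mul_of_lt hL m n h
  · rw [mul_comm]
    exact apply_jacobiPoly_mul_of_lt hL n m h

/-- Evaluate `L (P n * X * P (n + 1))` twice, letting `X` act on either factor. -/
lemma apply_jacobiPoly_mul_self {L : ℝ[X] →ₗ[ℝ] ℝ} {B G : ℕ → ℝ} (h1 : L 1 = 1)
    (hL : ∀ n, L (jacobiPoly B G (n + 1)) = 0) (n : ℕ) :
    L (jacobiPoly B G n * jacobiPoly B G n) = ∏ i ∈ Finset.range n, G i := by
  induction n with
  | zero => simp [jacobiPoly, h1]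
  | succ n ih =>
    have hX : jacobiPoly B G n * (X * jacobiPoly B G (n + 1)) =
        jacobiPoly B G n * jacobiPoly B G (n + 2)
        + B (n + 1) • (jacobiPoly B G n * jacobiPoly B G (n + 1))
        + G n • (jacobiPoly B G n * jacobiPoly B G n) := by
      rw [X_mul_jacobiPoly_succ]
      simp only [smul_eq_C_mul]
      ring
    have e1 : L (jacobiPoly B G n * (X * jacobiPoly B G (n + 1)))
        = G n * ∏ i ∈ Finset.range n, G i := by
      simp [hX, ih, apply_jacobiPoly_mul_of_ne hL]
    have e2 : L (jacobiPoly B G n * (X * jacobiPoly B G (n + 1)))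
        = L (jacobiPoly B G (n + 1) * jacobiPoly B G (n + 1)) := by
      rcases n with _ | n
      · have : jacobiPoly B G 0 * (X * jacobiPoly B G 1) =
            jacobiPoly B G 1 * jacobiPoly B G 1
            + B 0 • (jacobiPoly B G 0 * jacobiPoly B G 1) := by
          rw [smul_eq_C_mul]
          linear_combination jacobiPoly B G 1 * X_mul_jacobiPoly_zero B G
        simp [this, apply_jacobiPoly_mul_of_ne hL]
      · have : jacobiPoly B G (n + 1) * (X * jacobiPoly B G (n + 2)) =
            jacobiPoly B G (n + 2) * jacobiPoly B G (n + 2)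
            + B (n + 1) • (jacobiPoly B G (n + 1) * jacobiPoly B G (n + 2))
            + G n • (jacobiPoly B G n * jacobiPoly B G (n + 2)) := by
          simp only [smul_eq_C_mul]
          linear_combination jacobiPoly B G (n + 2) * X_mul_jacobiPoly_succ B G n
        simp [this, apply_jacobiPoly_mul_of_ne hL]
    rw [← e2, e1, Finset.prod_range_succ, mul_comm]

lemma apply_X_mul_jacobiPoly_mul_self {L : ℝ[X] →ₗ[ℝ] ℝ} {B G : ℕ → ℝ} (h1 : L 1 = 1)
    (hL : ∀ n, L (jacobiPoly B G (n + 1)) = 0) (n : ℕ) :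
    L (X * (jacobiPoly B G n * jacobiPoly B G n)) = B n * ∏ i ∈ Finset.range n, G i := by
  have hn := apply_jacobiPoly_mul_self h1 hL n
  rcases n with _ | n
  · have : X * (jacobiPoly B G 0 * jacobiPoly B G 0) = jacobiPoly B G 1 * jacobiPoly B G 0
        + B 0 • (jacobiPoly B G 0 * jacobiPoly B G 0) := by
      rw [smul_eq_C_mul]
      linear_combination jacobiPoly B G 0 * X_mul_jacobiPoly_zero B G
    simp [this, hn, apply_jacobiPoly_mul_of_ne hL]
  · have : X * (jacobiPoly B G (n + 1) * jacobiPoly B G (n + 1)) =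
        jacobiPoly B G (n + 2) * jacobiPoly B G (n + 1)
        + B (n + 1) • (jacobiPoly B G (n + 1) * jacobiPoly B G (n + 1))
        + G n • (jacobiPoly B G n * jacobiPoly B G (n + 1)) := by
      simp only [smul_eq_C_mul]
      linear_combination jacobiPoly B G (n + 1) * X_mul_jacobiPoly_succ B G n
    simp [this, hn, apply_jacobiPoly_mul_of_ne hL]

lemma jacobiPoly_monic_and_natDegree (B G : ℕ → ℝ) :
    ∀ n : ℕ, (jacobiPoly B G n).Monic ∧ (jacobiPoly B G n).natDegree = n
  | 0 => by simp [jacobiPoly]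
  | 1 => by simp [jacobiPoly, monic_X_sub_C]
  | n + 2 => by
    obtain ⟨hm1, hd1⟩ := jacobiPoly_monic_and_natDegree B G (n + 1)
    obtain ⟨-, hd0⟩ := jacobiPoly_monic_and_natDegree B G n
    have hm : ((X - C (B (n + 1))) * jacobiPoly B G (n + 1)).Monic := (monic_X_sub_C _).mul hm1
    have hd : ((X - C (B (n + 1))) * jacobiPoly B G (n + 1)).natDegree = n + 2 := by
      rw [(monic_X_sub_C _).natDegree_mul hm1, natDegree_X_sub_C, hd1]
      omega
    have hlt : (C (G n) * jacobiPoly B G n).natDegree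
        < ((X - C (B (n + 1))) * jacobiPoly B G (n + 1)).natDegree := by
      have := natDegree_C_mul_le (G n) (jacobiPoly B G n)
      omega
    rw [jacobiPoly]
    exact ⟨hm.sub_of_left (degree_lt_degree hlt),
      by rw [natDegree_sub_eq_left_of_natDegree_lt hlt, hd]⟩

lemma jacobiPoly_congr {B G B' G' : ℕ → ℝ} : ∀ n : ℕ, (∀ i < n, B i = B' i) →
    (∀ i, i + 1 < n → G i = G' i) → jacobiPoly B G n = jacobiPoly B' G' n
  | 0, _, _ => rfl
  | 1, hB, _ => by simp [jacobiPoly, hB]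
  | n + 2, hB, hG => by
    rw [jacobiPoly, jacobiPoly, jacobiPoly_congr (n + 1) (fun i hi => hB i (by omega))
      (fun i hi => hG i (by omega)), jacobiPoly_congr n (fun i hi => hB i (by omega))
      (fun i hi => hG i (by omega)), hB (n + 1) (by omega), hG n (by omega)]

/-! ### Recovering Jacobi parameters from moments -/

/-- The linear functional with moments `jacobiCoeff B G m 0`. -/
def jacobiFunctional (B G : ℕ → ℝ) : ℝ[X] →ₗ[ℝ] ℝ :=
  Polynomial.lsum fun m => (jacobiCoeff B G m 0) • LinearMap.id

lemma jacobiFunctional_X_pow (B G : ℕ → ℝ) (m : ℕ) :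
    jacobiFunctional B G (X ^ m) = jacobiCoeff B G m 0 := by
  simp [jacobiFunctional, ← monomial_one_right_eq_X_pow, sum_monomial_index]

lemma jacobiFunctional_one (B G : ℕ → ℝ) : jacobiFunctional B G 1 = 1 := by
  simpa [jacobiCoeff] using jacobiFunctional_X_pow B G 0

lemma jacobiFunctional_jacobiPoly (B G : ℕ → ℝ) (n : ℕ) :
    jacobiFunctional B G (jacobiPoly B G (n + 1)) = 0 :=
  (moments_eq_jacobiCoeff_iff _ (jacobiFunctional_one B G) B G).1 (jacobiFunctional_X_pow B G) n

/-- Terms of lower degree cancel, so the first discrepancy of moments can be tested on any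
convenient monic polynomial. -/
lemma sub_apply_eq_of_monic {L L' : ℝ[X] →ₗ[ℝ] ℝ} {d : ℕ}
    (h : ∀ k < d, L (X ^ k) = L' (X ^ k)) {p : ℝ[X]} (hp : p.Monic) (hd : p.natDegree = d) :
    L (X ^ d) - L' (X ^ d) = L p - L' p := by
  have hpd : p.coeff d = 1 := by rw [← hd]; exact hp
  have : ∀ M : ℝ[X] →ₗ[ℝ] ℝ, M p = ∑ k ∈ Finset.range d, p.coeff k * M (X ^ k) + M (X ^ d) := by
    intro M
    conv_lhs => rw [p.as_sum_range_C_mul_X_pow, hd, Finset.sum_range_succ, hpd]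
    simp [← smul_eq_C_mul]
  rw [this L, this L', Finset.sum_congr rfl fun k hk => by rw [h k (Finset.mem_range.1 hk)]]
  ring

/-- Two moment sequences which agree up to order `2 n` and whose first `n` Jacobi parameters agree
differ at order `2 n + 1` by the difference of the next diagonal parameters. -/
lemma jacobiCoeff_sub_odd {B G B' G' : ℕ → ℝ} {n : ℕ} (hB : ∀ i < n, B i = B' i)
    (hG : ∀ i < n, G i = G' i)
    (h : ∀ k < 2 * n + 1, jacobiCoeff B G k 0 = jacobiCoeff B' G' k 0) :
    jacobiCoeff B G (2 * n + 1) 0 - jacobiCoeff B' G' (2 * n + 1) 0 =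
      (∏ i ∈ Finset.range n, G' i) * (B n - B' n) := by
  obtain ⟨hm, hd⟩ := jacobiPoly_monic_and_natDegree B G n
  -- The test polynomial is `X * (P n)²`; `P n` only involves parameters of index below `n`, hence
  -- is common to both sequences.
  have hmm : (X * (jacobiPoly B G n * jacobiPoly B G n)).Monic := monic_X.mul (hm.mul hm)
  have hdd : (X * (jacobiPoly B G n * jacobiPoly B G n)).natDegree = 2 * n + 1 := by
    rw [monic_X.natDegree_mul (hm.mul hm), hm.natDegree_mul hm, hd, natDegree_X]
    ring
  have key := sub_apply_eq_of_monic (L := jacobiFunctional B G) (L' := jacobiFunctional B' G')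
    (by simpa only [jacobiFunctional_X_pow] using h) hmm hdd
  simp only [jacobiFunctional_X_pow] at key
  rw [key, apply_X_mul_jacobiPoly_mul_self (jacobiFunctional_one B G)
    (jacobiFunctional_jacobiPoly B G), jacobiPoly_congr n hB fun i hi => hG i (by omega),
    apply_X_mul_jacobiPoly_mul_self (jacobiFunctional_one B' G')
    (jacobiFunctional_jacobiPoly B' G'),
    Finset.prod_congr rfl fun i hi => hG i (Finset.mem_range.1 hi)]
  ring

/-- Here the test polynomial is `(P (n + 1))²`. -/
lemma jacobiCoeff_sub_even {B G B' G' : ℕ → ℝ} {n : ℕ} (hB : ∀ i < n + 1, B i = B' i)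
    (hG : ∀ i < n, G i = G' i)
    (h : ∀ k < 2 * n + 2, jacobiCoeff B G k 0 = jacobiCoeff B' G' k 0) :
    jacobiCoeff B G (2 * n + 2) 0 - jacobiCoeff B' G' (2 * n + 2) 0 =
      (∏ i ∈ Finset.range n, G' i) * (G n - G' n) := by
  obtain ⟨hm, hd⟩ := jacobiPoly_monic_and_natDegree B G (n + 1)
  have hdd : (jacobiPoly B G (n + 1) * jacobiPoly B G (n + 1)).natDegree = 2 * n + 2 := by
    rw [hm.natDegree_mul hm, hd]
    ring
  have key := sub_apply_eq_of_monic (L := jacobiFunctional B G) (L' := jacobiFunctional B' G')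
    (by simpa only [jacobiFunctional_X_pow] using h) (hm.mul hm) hdd
  simp only [jacobiFunctional_X_pow] at key
  rw [key, apply_jacobiPoly_mul_self (jacobiFunctional_one B G)
    (jacobiFunctional_jacobiPoly B G), jacobiPoly_congr (n + 1) hB fun i hi => hG i (by omega),
    apply_jacobiPoly_mul_self (jacobiFunctional_one B' G')
    (jacobiFunctional_jacobiPoly B' G'), Finset.prod_range_succ, Finset.prod_range_succ,
    Finset.prod_congr rfl fun i hi => hG i (Finset.mem_range.1 hi)]
  ring

/-! ### Meixner moments: convolution identity and growth -/

/-- The exponential generating function `∑ m, k! * jacobiCoeff B G m k * z ^ m / m!`. -/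
def jacobiSeries (B G : ℕ → ℝ) (k : ℕ) : PowerSeries ℝ :=
  PowerSeries.mk fun m => (k.factorial : ℝ) * jacobiCoeff B G m k / (m.factorial : ℝ)

/-- The diagonal Jacobi parameters of a Meixner family. -/
def meixnerDiag (β b t : ℝ) (n : ℕ) : ℝ := n * b + β * t

/-- The off-diagonal Jacobi parameters of a Meixner family. -/
def meixnerOffDiag (γ c t : ℝ) (n : ℕ) : ℝ := (n + 1) * (n * c + γ * t)

lemma coeff_zero_jacobiSeries (B G : ℕ → ℝ) (k : ℕ) :
    PowerSeries.coeff 0 (jacobiSeries B G k) = if k = 0 then 1 else 0 := by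
  rcases k with _ | k <;> simp [jacobiSeries, jacobiCoeff]

/-- The weight `k!` absorbs the factor `k + 1` of the off-diagonal parameter. All coefficients
become additive in `(k, t)`, which is what makes the series multiplicative. -/
lemma derivative_jacobiSeries_meixner (β γ b c t : ℝ) (k : ℕ) :
    PowerSeries.derivative ℝ (jacobiSeries (meixnerDiag β b t) (meixnerOffDiag γ c t) k) =
      (k : ℝ) • jacobiSeries (meixnerDiag β b t) (meixnerOffDiag γ c t) (k - 1)
      + (k * b + β * t) • jacobiSeries (meixnerDiag β b t) (meixnerOffDiag γ c t) k
      + (k * c + γ * t) • jacobiSeries (meixnerDiag β b t) (meixnerOffDiag γ c t) (k + 1) := by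
  ext m
  have hm : (m.factorial : ℝ) ≠ 0 := by positivity
  have hm' : (m : ℝ) + 1 ≠ 0 := by positivity
  rcases k with _ | k
  · simp [PowerSeries.coeff_derivative, jacobiSeries, jacobiCoeff, Nat.factorial_succ, meixnerDiag,
      meixnerOffDiag]
    field_simp
  · simp [PowerSeries.coeff_derivative, jacobiSeries, jacobiCoeff, Nat.factorial_succ, meixnerDiag,
      meixnerOffDiag]
    field_simp

/-- Both sides have the same constant terms and, by Leibniz and additivity of the coefficients,
satisfy the same differential system. The induction on the coefficient treats all `k`, `l` at once.
-/
lemma jacobiSeries_meixner_mul (β γ b c s t : ℝ) (k l : ℕ) :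
    jacobiSeries (meixnerDiag β b s) (meixnerOffDiag γ c s) k *
        jacobiSeries (meixnerDiag β b t) (meixnerOffDiag γ c t) l =
      jacobiSeries (meixnerDiag β b (s + t)) (meixnerOffDiag γ c (s + t)) (k + l) := by
  ext m
  induction m generalizing k l with
  | zero =>
    simp only [PowerSeries.coeff_mul, Finset.HasAntidiagonal.antidiagonal_zero, Finset.sum_singleton,
      coeff_zero_jacobiSeries]
    rcases k with _ | k <;> rcases l with _ | l <;> simp
  | succ m ih =>
    have hm : (m : ℝ) + 1 ≠ 0 := by positivity
    refine mul_right_cancel₀ hm ?_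
    rw [← PowerSeries.coeff_derivative, ← PowerSeries.coeff_derivative, Derivation.leibniz,
      derivative_jacobiSeries_meixner, derivative_jacobiSeries_meixner,
      derivative_jacobiSeries_meixner]
    have e1 := ih k (l - 1)
    have e2 := ih (k - 1) l
    have e3 := ih k l
    have e4 := ih (k + 1) l
    have e5 := ih k (l + 1)
    simp only [smul_eq_mul, mul_add, mul_smul_comm, map_add, PowerSeries.coeff_smul]
    rw [mul_comm (jacobiSeries _ _ l), mul_comm (jacobiSeries _ _ l), mul_comm (jacobiSeries _ _ l),
      e1, e2, e3, e4, e5]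
    -- The truncated `l - 1` is harmless: at `l = 0` the factor `l` kills the term.
    have f1 : (l : ℝ) * (PowerSeries.coeff m) (jacobiSeries (meixnerDiag β b (s + t))
          (meixnerOffDiag γ c (s + t)) (k + (l - 1))) =
        (l : ℝ) * (PowerSeries.coeff m) (jacobiSeries (meixnerDiag β b (s + t))
          (meixnerOffDiag γ c (s + t)) (k + l - 1)) := by
      rcases l with _ | l
      · simp
      · rfl
    have f2 : (k : ℝ) * (PowerSeries.coeff m) (jacobiSeries (meixnerDiag β b (s + t))
          (meixnerOffDiag γ c (s + t)) (k - 1 + l)) =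
        (k : ℝ) * (PowerSeries.coeff m) (jacobiSeries (meixnerDiag β b (s + t))
          (meixnerOffDiag γ c (s + t)) (k + l - 1)) := by
      rcases k with _ | k
      · simp
      · congr 4
        omega
    rw [f1, f2, show k + 1 + l = k + l + 1 by ring, show k + (l + 1) = k + l + 1 by ring]
    push_cast
    ring

/-- The moments of a Meixner family satisfy the binomial convolution identity. -/
lemma jacobiCoeff_meixner_add (β γ b c s t : ℝ) (n : ℕ) :
    jacobiCoeff (meixnerDiag β b (s + t)) (meixnerOffDiag γ c (s + t)) n 0 =
      ∑ k ∈ Finset.range (n + 1), (n.choose k : ℝ) *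
        (jacobiCoeff (meixnerDiag β b s) (meixnerOffDiag γ c s) k 0 *
          jacobiCoeff (meixnerDiag β b t) (meixnerOffDiag γ c t) (n - k) 0) := by
  have h := congrArg (PowerSeries.coeff n) (jacobiSeries_meixner_mul β γ b c s t 0 0)
  have hn : (n.factorial : ℝ) ≠ 0 := by positivity
  rw [PowerSeries.coeff_mul, Finset.Nat.sum_antidiagonal_eq_sum_range_succ_mk] at h
  simp only [jacobiSeries, PowerSeries.coeff_mk, Nat.factorial_zero, Nat.cast_one, one_mul,
    add_zero] at h
  rw [eq_div_iff hn, Finset.sum_mul] at h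
  rw [← h]
  refine Finset.sum_congr rfl fun k hk => ?_
  have hk' : k ≤ n := by simpa [Nat.lt_succ_iff] using hk
  rw [Nat.cast_choose ℝ hk']
  have h1 : (k.factorial : ℝ) ≠ 0 := by positivity
  have h2 : ((n - k).factorial : ℝ) ≠ 0 := by positivity
  field_simp

lemma abs_jacobiCoeff_meixner_le (β γ b c t : ℝ) : ∃ A : ℝ, 0 < A ∧ ∀ m k : ℕ,
    (k.factorial : ℝ) * |jacobiCoeff (meixnerDiag β b t) (meixnerOffDiag γ c t) m k| ≤
      A ^ m * (m.factorial : ℝ) := by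
  set B := meixnerDiag β b t with hB
  set G := meixnerOffDiag γ c t with hG
  -- One summand for each of the three terms of the recurrence. Each term costs at most a factor `m
  -- + 1`, since only indices `k ≤ m` contribute.
  set A : ℝ := 1 + (|b| + |β * t|) + (|c| + |γ * t|) with hA
  have hA0 : 0 < A := by positivity
  refine ⟨A, hA0, fun m => ?_⟩
  induction m with
  | zero => intro k; rcases k with _ | k <;> simp [jacobiCoeff]
  | succ m ih =>
    have hb : ∀ k : ℕ, k ≤ m → |B k| ≤ (|b| + |β * t|) * (m + 1) := by
      intro k hk
      have hk' : (k : ℝ) ≤ m := by exact_mod_cast hk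
      calc |B k| ≤ |(k : ℝ) * b| + |β * t| := abs_add_le _ _
        _ = k * |b| + |β * t| := by rw [abs_mul, Nat.abs_cast]
        _ ≤ _ := by nlinarith [abs_nonneg b, abs_nonneg (β * t), (Nat.cast_nonneg m : (0:ℝ) ≤ m)]
    have hg : ∀ k : ℕ, k ≤ m → |G k| ≤ (k + 1) * ((|c| + |γ * t|) * (m + 1)) := by
      intro k hk
      have hk' : (k : ℝ) ≤ m := by exact_mod_cast hk
      have : |(k : ℝ) * c + γ * t| ≤ (|c| + |γ * t|) * (m + 1) := by
        calc |(k : ℝ) * c + γ * t| ≤ |(k : ℝ) * c| + |γ * t| := abs_add_le _ _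
          _ = k * |c| + |γ * t| := by rw [abs_mul, Nat.abs_cast]
          _ ≤ _ := by
            nlinarith [abs_nonneg c, abs_nonneg (γ * t), (Nat.cast_nonneg m : (0:ℝ) ≤ m)]
      rw [hG, meixnerOffDiag, abs_mul, abs_of_nonneg (by positivity : (0 : ℝ) ≤ (k : ℝ) + 1)]
      gcongr
    have hdiag : ∀ k, (k.factorial : ℝ) * (|B k| * |jacobiCoeff B G m k|) ≤
        (|b| + |β * t|) * (m + 1) * (A ^ m * m.factorial) := by
      intro k
      by_cases hk : k ≤ m
      · rw [mul_left_comm]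
        exact mul_le_mul (hb k hk) (ih k) (by positivity) (by positivity)
      · rw [jacobiCoeff_eq_zero_of_lt B G m k (by omega)]
        simp
        positivity
    have hoff : ∀ k, (k.factorial : ℝ) * (|G k| * |jacobiCoeff B G m (k + 1)|) ≤
        (|c| + |γ * t|) * (m + 1) * (A ^ m * m.factorial) := by
      intro k
      by_cases hk : k ≤ m
      · calc (k.factorial : ℝ) * (|G k| * |jacobiCoeff B G m (k + 1)|)
            ≤ (k.factorial : ℝ) * ((k + 1) * ((|c| + |γ * t|) * (m + 1)) *
                |jacobiCoeff B G m (k + 1)|) := by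
              gcongr
              exact hg k hk
          _ = (|c| + |γ * t|) * (m + 1) *
                (((k + 1).factorial : ℝ) * |jacobiCoeff B G m (k + 1)|) := by
              rw [Nat.factorial_succ]; push_cast; ring
          _ ≤ _ := mul_le_mul_of_nonneg_left (ih (k + 1)) (by positivity)
      · rw [jacobiCoeff_eq_zero_of_lt B G m (k + 1) (by omega)]
        simp
        positivity
    have hlow : ∀ k, ((k + 1).factorial : ℝ) * |jacobiCoeff B G m k| ≤
        1 * (m + 1) * (A ^ m * m.factorial) := by
      intro k
      by_cases hk : k ≤ m
      · have hk' : (k : ℝ) ≤ m := by exact_mod_cast hk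
        calc ((k + 1).factorial : ℝ) * |jacobiCoeff B G m k|
            = (k + 1) * (k.factorial * |jacobiCoeff B G m k|) := by
              rw [Nat.factorial_succ]; push_cast; ring
          _ ≤ (m + 1) * (A ^ m * m.factorial) :=
            mul_le_mul (by linarith) (ih k) (by positivity) (by positivity)
          _ = _ := by ring
      · rw [jacobiCoeff_eq_zero_of_lt B G m k (by omega)]
        simp
        positivity
    have hfin : A ^ (m + 1) * ((m + 1).factorial : ℝ) = 1 * (m + 1) * (A ^ m * m.factorial)
        + (|b| + |β * t|) * (m + 1) * (A ^ m * m.factorial)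
        + (|c| + |γ * t|) * (m + 1) * (A ^ m * m.factorial) := by
      rw [Nat.factorial_succ, pow_succ, hA]
      push_cast
      ring
    have hpos : 0 ≤ 1 * ((m : ℝ) + 1) * (A ^ m * m.factorial) := by positivity
    intro k
    rw [hfin]
    rcases k with _ | k
    · have h2 := hdiag 0
      have h3 := hoff 0
      have := abs_add_le (B 0 * jacobiCoeff B G m 0) (G 0 * jacobiCoeff B G m 1)
      simp only [Nat.factorial_zero, Nat.cast_one, one_mul, zero_add, jacobiCoeff, abs_mul]
        at h2 h3 this hpos ⊢
      linarith
    · have h1 := hlow k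
      have h2 := hdiag (k + 1)
      have h3 := hoff (k + 1)
      have h4 := abs_add_three (jacobiCoeff B G m k) (B (k + 1) * jacobiCoeff B G m (k + 1))
        (G (k + 1) * jacobiCoeff B G m (k + 2))
      rw [abs_mul, abs_mul] at h4
      have h5 := mul_le_mul_of_nonneg_left h4 (Nat.cast_nonneg (α := ℝ) (k + 1).factorial)
      rw [jacobiCoeff]
      linarith

/-! ### Determinacy of the moment problem under factorial growth -/

/-- The series of `cosh` has nonnegative terms, so it can be integrated termwise, and the moment
bound makes it a convergent geometric series. It then dominates the exponential. -/
lemma integrable_cosh_of_moments_le {μ : Measure ℝ} (hμ : HasFiniteMoments μ) {A : ℝ}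
    (hA : 0 < A) (h : ∀ m, |∫ x, x ^ m ∂μ| ≤ A ^ m * (m.factorial : ℝ)) {v : ℝ}
    (hv : |v| * A < 1) : Integrable (fun x => Real.cosh (v * x)) μ := by
  set F : ℕ → ℝ → ℝ := fun n x => (v * x) ^ (2 * n) / ((2 * n).factorial : ℝ) with hF
  have hF0 : ∀ n x, 0 ≤ F n x := fun n x =>
    div_nonneg (Even.pow_nonneg (even_two_mul n) _) (by positivity)
  have hFeq : ∀ n x, F n x = v ^ (2 * n) / ((2 * n).factorial : ℝ) * x ^ (2 * n) := by
    intro n x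
    simp only [hF, mul_pow]
    ring
  have hFint : ∀ n, Integrable (F n) μ := by
    intro n
    rw [show F n = fun x => v ^ (2 * n) / ((2 * n).factorial : ℝ) * x ^ (2 * n) from
      funext (hFeq n)]
    exact (hμ (2 * n)).const_mul _
  have hbound : ∀ n, ∫ x, F n x ∂μ ≤ ((|v| * A) ^ 2) ^ n := by
    intro n
    have hfac : ((2 * n).factorial : ℝ) ≠ 0 := by positivity
    calc ∫ x, F n x ∂μ
        = v ^ (2 * n) / ((2 * n).factorial : ℝ) * ∫ x, x ^ (2 * n) ∂μ := by
          simp only [hFeq, integral_const_mul]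
      _ ≤ |v| ^ (2 * n) / ((2 * n).factorial : ℝ) * (A ^ (2 * n) * (2 * n).factorial) := by
          rw [Even.pow_abs (even_two_mul n)]
          exact mul_le_mul_of_nonneg_left ((le_abs_self _).trans (h _))
            (div_nonneg (Even.pow_nonneg (even_two_mul n) _) (by positivity))
      _ = ((|v| * A) ^ 2) ^ n := by
          rw [← pow_mul, mul_pow]
          field_simp
  have hr : (|v| * A) ^ 2 < 1 := by
    have : 0 ≤ |v| * A := by positivity
    nlinarith
  have hsum : Summable fun n => ∫ x, F n x ∂μ :=
    Summable.of_nonneg_of_le (fun n => integral_nonneg (hF0 n)) hbound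
      (summable_geometric_of_lt_one (by positivity) hr)
  have hmeas : AEStronglyMeasurable (fun x => Real.cosh (v * x)) μ :=
    (by fun_prop : Continuous fun x => Real.cosh (v * x)).aestronglyMeasurable
  refine ⟨hmeas, ?_⟩
  rw [hasFiniteIntegral_iff_ofReal (Filter.Eventually.of_forall fun x => (Real.cosh_pos _).le)]
  have hpt : ∀ x, ENNReal.ofReal (Real.cosh (v * x)) = ∑' n, ENNReal.ofReal (F n x) := by
    intro x
    rw [← ENNReal.ofReal_tsum_of_nonneg (fun n => hF0 n x) (Real.hasSum_cosh (v * x)).summable,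
      (Real.hasSum_cosh (v * x)).tsum_eq]
  simp only [hpt]
  rw [lintegral_tsum fun n => (hFint n).aestronglyMeasurable.aemeasurable.ennreal_ofReal]
  simp only [← ofReal_integral_eq_lintegral_ofReal (hFint _)
    (Filter.Eventually.of_forall (hF0 _))]
  rw [← ENNReal.ofReal_tsum_of_nonneg (fun n => integral_nonneg (hF0 n)) hsum]
  exact ENNReal.ofReal_lt_top

lemma mem_integrableExpSet_of_moments_le {μ : Measure ℝ} (hμ : HasFiniteMoments μ) {A : ℝ}
    (hA : 0 < A) (h : ∀ m, |∫ x, x ^ m ∂μ| ≤ A ^ m * (m.factorial : ℝ)) {v : ℝ}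
    (hv : |v| * A < 1) : v ∈ ProbabilityTheory.integrableExpSet id μ := by
  refine ((integrable_cosh_of_moments_le hμ hA h hv).const_mul 2).mono'
    (by fun_prop : Continuous fun x : ℝ => Real.exp (v * id x)).aestronglyMeasurable
    (Filter.Eventually.of_forall fun x => ?_)
  rw [Real.norm_of_nonneg (Real.exp_pos _).le, Real.cosh_eq]
  simp only [id]
  linarith [Real.exp_pos (-(v * x))]

/-- A measure whose moments are bounded by `A ^ m * m!` is determined by its moments. -/
lemma measure_ext_of_moments {μ ν : Measure ℝ} [IsFiniteMeasure μ] [IsFiniteMeasure ν]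
    (hμ : HasFiniteMoments μ) (hν : HasFiniteMoments ν)
    (hμν : ∀ m : ℕ, ∫ x, x ^ m ∂μ = ∫ x, x ^ m ∂ν) {A : ℝ} (hA : 0 < A)
    (h : ∀ m, |∫ x, x ^ m ∂μ| ≤ A ^ m * (m.factorial : ℝ)) : μ = ν := by
  have hsub : ∀ {ρ : Measure ℝ}, HasFiniteMoments ρ →
      (∀ m, |∫ x, x ^ m ∂ρ| ≤ A ^ m * (m.factorial : ℝ)) →
      Set.Ioo (-A⁻¹) A⁻¹ ⊆ interior (ProbabilityTheory.integrableExpSet id ρ) := by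
    intro ρ hρ hb
    refine interior_maximal (fun v hv => mem_integrableExpSet_of_moments_le hρ hA hb ?_) isOpen_Ioo
    rw [← lt_div_iff₀ hA, one_div]
    exact abs_lt.2 hv
  have hsμ := hsub hμ h
  have hsν := hsub hν fun m => hμν m ▸ h m
  -- On this strip both complex moment generating functions are analytic. Their Taylor coefficients
  -- at `0` are given by the moments, so they agree on the strip, and the imaginary axis gives the
  -- characteristic functions.
  set U : Set ℂ := {z | z.re ∈ Set.Ioo (-A⁻¹) A⁻¹} with hU
  have h0 : (0 : ℝ) ∈ Set.Ioo (-A⁻¹) A⁻¹ := by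
    have := inv_pos.2 hA
    constructor <;> linarith
  have hUc : IsPreconnected U :=
    ((convex_Ioo (-A⁻¹) A⁻¹).linear_preimage Complex.reLm).isPreconnected
  have hμa : AnalyticOnNhd ℂ (ProbabilityTheory.complexMGF id μ) U := fun z hz =>
    ProbabilityTheory.analyticAt_complexMGF (hsμ hz)
  have hνa : AnalyticOnNhd ℂ (ProbabilityTheory.complexMGF id ν) U := fun z hz =>
    ProbabilityTheory.analyticAt_complexMGF (hsν hz)
  have hU0 : (0 : ℂ) ∈ U := by simpa [hU] using h0
  have hderiv : ∀ n, iteratedDeriv n (ProbabilityTheory.complexMGF id μ) 0 =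
      iteratedDeriv n (ProbabilityTheory.complexMGF id ν) 0 := by
    intro n
    rw [ProbabilityTheory.iteratedDeriv_complexMGF (hsμ hU0),
      ProbabilityTheory.iteratedDeriv_complexMGF (hsν hU0)]
    simp only [id, zero_mul, Complex.exp_zero, mul_one]
    have := congrArg (fun x : ℝ => (x : ℂ)) (hμν n)
    simpa only [← integral_complex_ofReal, Complex.ofReal_pow] using this
  have hev : ProbabilityTheory.complexMGF id μ =ᶠ[nhds 0] ProbabilityTheory.complexMGF id ν := by
    have e1 := (hμa 0 hU0).hasFPowerSeriesAt.eventually_hasSum_sub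
    have e2 := (hνa 0 hU0).hasFPowerSeriesAt.eventually_hasSum_sub
    filter_upwards [e1, e2] with z h1 h2
    simp only [hderiv] at h1
    exact h1.unique h2
  have heq := hμa.eqOn_of_preconnected_of_eventuallyEq hνa hUc hU0 hev
  refine Measure.ext_of_charFun (funext fun t => ?_)
  rw [← ProbabilityTheory.complexMGF_id_mul_I, ← ProbabilityTheory.complexMGF_id_mul_I]
  refine heq ?_
  simpa [hU] using h0

/-! ### Moments of measures and of convolutions -/

lemma hasFiniteMoments_conv {μ ν : Measure ℝ} [IsFiniteMeasure μ] [IsFiniteMeasure ν]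
    (hμ : HasFiniteMoments μ) (hν : HasFiniteMoments ν) : HasFiniteMoments (μ.conv ν) := by
  intro n
  rw [Measure.conv, integrable_map_measure (by fun_prop) (by fun_prop)]
  simp only [Function.comp_def, add_pow]
  exact integrable_finsetSum _ fun k _ => ((hμ k).mul_prod (hν (n - k))).mul_const _

lemma integral_pow_conv {μ ν : Measure ℝ} [IsFiniteMeasure μ] [IsFiniteMeasure ν]
    (hμ : HasFiniteMoments μ) (hν : HasFiniteMoments ν) (n : ℕ) :
    ∫ x, x ^ n ∂(μ.conv ν) = ∑ k ∈ Finset.range (n + 1), (n.choose k : ℝ) *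
      ((∫ x, x ^ k ∂μ) * ∫ x, x ^ (n - k) ∂ν) := by
  rw [Measure.conv, integral_map (by fun_prop) (by fun_prop)]
  simp only [add_pow]
  rw [integral_finsetSum _ fun k _ => ((hμ k).mul_prod (hν (n - k))).mul_const _]
  refine Finset.sum_congr rfl fun k _ => ?_
  rw [integral_mul_const, integral_prod_mul (fun x : ℝ => x ^ k) fun y : ℝ => y ^ (n - k),
    mul_comm]

lemma HasFiniteMoments.integrable_eval {μ : Measure ℝ} (hμ : HasFiniteMoments μ) (p : ℝ[X]) :
    Integrable (fun x => p.eval x) μ := by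
  simp only [eval_eq_sum_range]
  exact integrable_finsetSum _ fun k _ => (hμ k).const_mul _

/-- Integration of polynomials against a measure all of whose moments are finite. -/
def momentFunctional (μ : Measure ℝ) (hμ : HasFiniteMoments μ) : ℝ[X] →ₗ[ℝ] ℝ where
  toFun p := ∫ x, p.eval x ∂μ
  map_add' p q := by
    simp only [eval_add]
    exact integral_add (hμ.integrable_eval p) (hμ.integrable_eval q)
  map_smul' r p := by simp [integral_const_mul]

/-- Jacobi parameters are determined by, and determine, the moments. -/
lemma hasJacobiParameters_iff {μ : Measure ℝ} [IsProbabilityMeasure μ] (hμ : HasFiniteMoments μ)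
    (B G : ℕ → ℝ) :
    HasJacobiParameters μ B G ↔ ∀ m : ℕ, ∫ x, x ^ m ∂μ = jacobiCoeff B G m 0 := by
  have h1 : momentFunctional μ hμ 1 = 1 := by simp [momentFunctional]
  have hmom : (∀ m : ℕ, ∫ x, x ^ m ∂μ = jacobiCoeff B G m 0) ↔
      ∀ m, momentFunctional μ hμ (X ^ m) = jacobiCoeff B G m 0 := by
    simp [momentFunctional]
  rw [hmom, moments_eq_jacobiCoeff_iff _ h1]
  constructor
  · rintro ⟨-, h⟩ n
    simpa [momentFunctional, jacobiPoly] using h (n + 1) 0 (by omega)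
  · intro h
    refine ⟨hμ, fun m n hmn => ?_⟩
    simpa [momentFunctional] using apply_jacobiPoly_mul_of_ne h hmn

/-- The product is the integral of the square of the `n`-th polynomial. -/
lemma prod_nonneg_of_moments_eq {μ : Measure ℝ} [IsProbabilityMeasure μ]
    (hμ : HasFiniteMoments μ) {B G : ℕ → ℝ}
    (h : ∀ m : ℕ, ∫ x, x ^ m ∂μ = jacobiCoeff B G m 0) (n : ℕ) :
    0 ≤ ∏ i ∈ Finset.range n, G i := by
  have h1 : momentFunctional μ hμ 1 = 1 := by simp [momentFunctional]
  have hL := (moments_eq_jacobiCoeff_iff (momentFunctional μ hμ) h1 B G).1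
    (by simpa [momentFunctional] using h)
  rw [← apply_jacobiPoly_mul_self h1 hL n]
  simp only [momentFunctional, LinearMap.coe_mk, AddHom.coe_mk, eval_mul]
  exact integral_nonneg fun x => mul_self_nonneg _

/-! ### Rigidity of polynomial Jacobi parameters -/

/-- Two sequences of functions which satisfy the binomial convolution identity and agree below `n`
differ at `n` by a linear function. -/
lemma sub_eq_mul_of_binomial_convolution {M M' : ℕ → ℝ → ℝ}
    (h : ∀ s t : ℕ, 1 ≤ s → 1 ≤ t → ∀ n, M n (s + t) =
      ∑ k ∈ Finset.range (n + 1), (n.choose k : ℝ) * (M k s * M (n - k) t))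
    (h' : ∀ s t : ℕ, 1 ≤ s → 1 ≤ t → ∀ n, M' n (s + t) =
      ∑ k ∈ Finset.range (n + 1), (n.choose k : ℝ) * (M' k s * M' (n - k) t))
    (h0 : ∀ t, M 0 t = 1) (h0' : ∀ t, M' 0 t = 1) {n : ℕ}
    (hlt : ∀ k < n + 1, ∀ t : ℕ, 1 ≤ t → M k t = M' k t) (t : ℕ) (ht : 1 ≤ t) :
    M (n + 1) t - M' (n + 1) t = t * (M (n + 1) 1 - M' (n + 1) 1) := by
  induction t, ht using Nat.le_induction with
  | base => simp
  | succ t ht ih =>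
    have e := h t 1 ht le_rfl (n + 1)
    have e' := h' t 1 ht le_rfl (n + 1)
    -- Only the two extreme terms contain a moment of order `n + 1`; the middle ones agree, so the
    -- difference is additive in the time.
    rw [Finset.sum_range_succ, Finset.sum_range_succ'] at e e'
    have hmid : ∀ k ∈ Finset.range n, ((n + 1).choose (k + 1) : ℝ) *
        (M (k + 1) t * M (n + 1 - (k + 1)) (1 : ℕ)) = ((n + 1).choose (k + 1) : ℝ) *
        (M' (k + 1) t * M' (n + 1 - (k + 1)) (1 : ℕ)) := by
      intro k hk
      have hk' := Finset.mem_range.1 hk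
      rw [hlt (k + 1) (by omega) t ht, hlt (n + 1 - (k + 1)) (by omega) 1 le_rfl]
    rw [Finset.sum_congr rfl hmid] at e
    simp only [Nat.choose_zero_right, Nat.choose_self, Nat.cast_one, Nat.sub_zero, Nat.sub_self,
      h0, h0', one_mul, mul_one] at e e'
    push_cast
    linear_combination e - e' + ih

/-- Agreement at infinitely many points gives `H * Q = d X`. This is impossible for `Q ≠ 0` by
degree when `2 ≤ H.natDegree`; when `Q` vanishes at `1`, evaluation there gives `d = 0`. -/
lemma eq_zero_of_mul_eval_eq {H Q : ℝ[X]} {d : ℝ} (hH : H ≠ 0)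
    (h : ∀ t : ℕ, 1 ≤ t → H.eval (t : ℝ) * Q.eval (t : ℝ) = t * d)
    (hor : 2 ≤ H.natDegree ∨ Q.eval 1 = 0) : Q = 0 ∧ d = 0 := by
  have hpoly : H * Q = C d * X := by
    refine eq_of_infinite_eval_eq _ _ ?_
    refine Set.Infinite.mono (s := Set.range fun n : ℕ => ((n + 1 : ℕ) : ℝ)) ?_
      (Set.infinite_range_of_injective fun m n hmn => by simpa using hmn)
    rintro _ ⟨n, rfl⟩
    have := h (n + 1) (by omega)
    simp only [Set.mem_ofPred_eq, eval_mul, eval_C, eval_X, this]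
    ring
  have hQ : Q = 0 := by
    rcases hor with hdeg | hQ1
    · by_contra hQ
      have := natDegree_mul hH hQ
      rw [hpoly] at this
      have := natDegree_C_mul_le d X
      rw [natDegree_X] at this
      omega
    · have := h 1 le_rfl
      simp only [Nat.cast_one, hQ1, mul_zero, one_mul] at this
      rw [← this, C_0, zero_mul] at hpoly
      exact (mul_eq_zero.1 hpoly).resolve_left hH
  refine ⟨hQ, ?_⟩
  have := h 1 le_rfl
  simpa [hQ] using this.symm

/-- The moment sequence for Jacobi parameters depending on a parameter. -/
def polyMoment (P Q : ℕ → ℝ[X]) (n : ℕ) (t : ℝ) : ℝ :=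
  jacobiCoeff (fun i => (P i).eval t) (fun i => (Q i).eval t) n 0

/-- The sequence of moments satisfies the binomial convolution identity at positive integers. -/
def ConvolvesMoments (P Q : ℕ → ℝ[X]) : Prop :=
  ∀ s t : ℕ, 1 ≤ s → 1 ≤ t → ∀ n, polyMoment P Q n (s + t) =
      ∑ k ∈ Finset.range (n + 1), (n.choose k : ℝ) *
        (polyMoment P Q k s * polyMoment P Q (n - k) t)

/-- The inductive step of rigidity: order `2 n + 1` settles the diagonal parameter, and then order
`2 n + 2` the off-diagonal one. -/
lemma eq_of_convolvesMoments_step {P Q P' Q' : ℕ → ℝ[X]} (h : ConvolvesMoments P Q)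
    (h' : ConvolvesMoments P' Q') {n : ℕ} (hP : ∀ i < n, P i = P' i) (hQ : ∀ i < n, Q i = Q' i)
    (hlt : ∀ k < 2 * n + 1, ∀ t : ℕ, 1 ≤ t → polyMoment P Q k t = polyMoment P' Q' k t)
    (hH : ∏ i ∈ Finset.range n, Q' i ≠ 0)
    (hor : 2 ≤ (∏ i ∈ Finset.range n, Q' i).natDegree ∨
      ((P n).eval 1 = (P' n).eval 1 ∧ (Q n).eval 1 = (Q' n).eval 1)) :
    P n = P' n ∧ Q n = Q' n ∧
      ∀ k < 2 * (n + 1) + 1, ∀ t : ℕ, 1 ≤ t → polyMoment P Q k t = polyMoment P' Q' k t := by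
  have hzero : ∀ (P Q : ℕ → ℝ[X]) (t : ℝ), polyMoment P Q 0 t = 1 := fun P Q t => by
    simp [polyMoment, jacobiCoeff]
  have hdiff1 : ∀ t : ℕ, 1 ≤ t → polyMoment P Q (2 * n + 1) t - polyMoment P' Q' (2 * n + 1) t =
      (∏ i ∈ Finset.range n, Q' i).eval (t : ℝ) * (P n - P' n).eval (t : ℝ) := by
    intro t ht
    rw [eval_prod, eval_sub]
    exact jacobiCoeff_sub_odd (fun i hi => by rw [hP i hi]) (fun i hi => by rw [hQ i hi])
      fun k hk => hlt k hk t ht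
  obtain ⟨hPn, hd1⟩ := eq_zero_of_mul_eval_eq hH
    (fun t ht => by
      rw [← hdiff1 t ht]
      exact sub_eq_mul_of_binomial_convolution h h' (hzero P Q) (hzero P' Q') hlt t ht)
    (hor.imp_right fun h => by rw [eval_sub, h.1, sub_self])
  rw [sub_eq_zero] at hPn
  have hlt2 : ∀ k < 2 * n + 2, ∀ t : ℕ, 1 ≤ t → polyMoment P Q k t = polyMoment P' Q' k t := by
    intro k hk t ht
    rcases (Nat.lt_succ_iff_lt_or_eq.1 hk) with hk | rfl
    · exact hlt k hk t ht
    · have := hdiff1 t ht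
      rw [hPn, sub_self, eval_zero, mul_zero, sub_eq_zero] at this
      exact this
  have hdiff2 : ∀ t : ℕ, 1 ≤ t → polyMoment P Q (2 * n + 2) t - polyMoment P' Q' (2 * n + 2) t =
      (∏ i ∈ Finset.range n, Q' i).eval (t : ℝ) * (Q n - Q' n).eval (t : ℝ) := by
    intro t ht
    rw [eval_prod, eval_sub]
    refine jacobiCoeff_sub_even (fun i hi => ?_) (fun i hi => by rw [hQ i hi])
      fun k hk => hlt2 k hk t ht
    rcases (Nat.lt_succ_iff_lt_or_eq.1 hi) with hi | rfl
    · rw [hP i hi]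
    · rw [hPn]
  obtain ⟨hQn, hd2⟩ := eq_zero_of_mul_eval_eq hH
    (fun t ht => by
      rw [← hdiff2 t ht]
      exact sub_eq_mul_of_binomial_convolution h h' (hzero P Q) (hzero P' Q') hlt2 t ht)
    (hor.imp_right fun h => by rw [eval_sub, h.2, sub_self])
  rw [sub_eq_zero] at hQn
  refine ⟨hPn, hQn, fun k hk t ht => ?_⟩
  rcases (Nat.lt_succ_iff_lt_or_eq.1 hk) with hk | rfl
  · exact hlt2 k hk t ht
  · have := hdiff2 t ht
    rw [hQn, sub_self, eval_zero, mul_zero, sub_eq_zero] at this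
    exact this

/-- The diagonal Jacobi parameters of a Meixner family as polynomials in the time. -/
def meixnerDiagPoly (β b : ℝ) (n : ℕ) : ℝ[X] := C (n * b) + C β * X

/-- The off-diagonal Jacobi parameters of a Meixner family as polynomials in the time. -/
def meixnerOffDiagPoly (γ c : ℝ) (n : ℕ) : ℝ[X] := C ((n : ℝ) + 1) * (C (n * c) + C γ * X)

lemma polyMoment_meixner (β γ b c : ℝ) (n : ℕ) (t : ℝ) :
    polyMoment (meixnerDiagPoly β b) (meixnerOffDiagPoly γ c) n t =
      jacobiCoeff (meixnerDiag β b t) (meixnerOffDiag γ c t) n 0 := by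
  simp only [polyMoment, meixnerDiagPoly, meixnerOffDiagPoly, eval_add, eval_mul, eval_C, eval_X]
  rfl

lemma convolvesMoments_meixner (β γ b c : ℝ) :
    ConvolvesMoments (meixnerDiagPoly β b) (meixnerOffDiagPoly γ c) := by
  intro s t _ _ n
  simp only [polyMoment_meixner]
  exact jacobiCoeff_meixner_add β γ b c s t n

lemma natDegree_meixnerOffDiagPoly {γ : ℝ} (hγ : γ ≠ 0) (c : ℝ) (n : ℕ) :
    (meixnerOffDiagPoly γ c n).natDegree = 1 := by
  rw [meixnerOffDiagPoly, natDegree_C_mul (by positivity), add_comm]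
  exact natDegree_linear hγ

lemma meixnerOffDiagPoly_ne_zero {γ : ℝ} (hγ : γ ≠ 0) (c : ℝ) (n : ℕ) :
    meixnerOffDiagPoly γ c n ≠ 0 := by
  intro h
  simpa [h] using natDegree_meixnerOffDiagPoly hγ c n

lemma jacobiCoeff_of_offDiag_zero {B G : ℕ → ℝ} (h : G 0 = 0) (m : ℕ) :
    jacobiCoeff B G m 0 = B 0 ^ m := by
  induction m with
  | zero => simp [jacobiCoeff]
  | succ m ih => rw [jacobiCoeff, ih, h, pow_succ']; ring

/-- Jacobi parameters which are polynomials in the time and whose moments convolve are those of a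
Meixner family. -/
lemma exists_meixner_of_convolvesMoments {P Q : ℕ → ℝ[X]} (h : ConvolvesMoments P Q) :
    ∃ β γ b c : ℝ, (γ = 0 → c = 0) ∧ ∀ n t, polyMoment P Q n t =
      jacobiCoeff (meixnerDiag β b t) (meixnerOffDiag γ c t) n 0 := by
  -- The constants solve `β₀(1) = β`, `γ₀(1) = γ`, `β₁(1) = b + β` and `γ₁(1) = 2 (c + γ)`.
  set β := (P 0).eval 1 with hβ
  set γ := (Q 0).eval 1 with hγ
  set b := (P 1).eval 1 - β with hb
  set c := (Q 1).eval 1 / 2 - γ with hc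
  have hstep := fun n => eq_of_convolvesMoments_step (n := n) h (convolvesMoments_meixner β γ b c)
  have hzero : P 0 = meixnerDiagPoly β b 0 ∧ Q 0 = meixnerOffDiagPoly γ c 0 ∧
      ∀ k < 2 * (0 + 1) + 1, ∀ t : ℕ, 1 ≤ t → polyMoment P Q k t =
        polyMoment (meixnerDiagPoly β b) (meixnerOffDiagPoly γ c) k t := by
    refine hstep 0 (by simp) (by simp) ?_ (by simp) (Or.inr ?_)
    · intro k hk t _
      obtain rfl : k = 0 := by omega
      simp [polyMoment, jacobiCoeff]
    · simp [meixnerDiagPoly, meixnerOffDiagPoly, hβ, hγ]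
  by_cases hγ0 : γ = 0
  -- With `γ = 0` the moments are powers of `β * t` whatever `b` and `c` are; zero is chosen to make
  -- `c` vanish along with `γ`.
  · refine ⟨β, γ, 0, 0, fun _ => rfl, fun n t => ?_⟩
    rw [polyMoment, jacobiCoeff_of_offDiag_zero, jacobiCoeff_of_offDiag_zero]
    · simp [hzero.1, meixnerDiagPoly, meixnerDiag]
    · simp [meixnerOffDiag, hγ0]
    · simp [hzero.2.1, meixnerOffDiagPoly, hγ0]
  · have main : ∀ n, (∀ i < n, P i = meixnerDiagPoly β b i) ∧
        (∀ i < n, Q i = meixnerOffDiagPoly γ c i) ∧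
        ∀ k < 2 * n + 1, ∀ t : ℕ, 1 ≤ t → polyMoment P Q k t =
          polyMoment (meixnerDiagPoly β b) (meixnerOffDiagPoly γ c) k t := by
      intro n
      induction n with
      | zero =>
        exact ⟨by simp, by simp, fun k hk => hzero.2.2 k (by omega)⟩
      | succ n ih =>
        obtain ⟨hP, hQ, hlt⟩ := ih
        have hne : ∀ i ∈ Finset.range n, meixnerOffDiagPoly γ c i ≠ 0 :=
          fun i _ => meixnerOffDiagPoly_ne_zero hγ0 c i
        obtain ⟨h1, h2, h3⟩ := hstep n hP hQ hlt (Finset.prod_ne_zero_iff.2 hne) (by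
          -- For `n < 2` the degree is too small and the values at `1` are used instead.
          rcases lt_or_ge n 2 with hn | hn
          · right
            interval_cases n
            · simp [meixnerDiagPoly, meixnerOffDiagPoly, hβ, hγ]
            · simp only [meixnerDiagPoly, meixnerOffDiagPoly, eval_add, eval_mul, eval_C, eval_X,
                Nat.cast_one, hb, hc]
              constructor <;> ring
          · left
            rw [natDegree_prod _ _ hne]
            simpa [natDegree_meixnerOffDiagPoly hγ0] using hn)
        refine ⟨fun i hi => ?_, fun i hi => ?_, h3⟩
        · rcases (Nat.lt_succ_iff_lt_or_eq.1 hi) with hi | rfl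
          exacts [hP i hi, h1]
        · rcases (Nat.lt_succ_iff_lt_or_eq.1 hi) with hi | rfl
          exacts [hQ i hi, h2]
    refine ⟨β, γ, b, c, fun h => absurd h hγ0, fun n t => ?_⟩
    rw [← polyMoment_meixner, show P = meixnerDiagPoly β b from
      funext fun i => (main (i + 1)).1 i (by omega), show Q = meixnerOffDiagPoly γ c from
      funext fun i => (main (i + 1)).2.1 i (by omega)]

/-! ### Positivity and the two implications -/

/-- The factors `k * c + γ * t` decrease to `-∞`. If none were zero, the product up to the first
negative one would be negative. -/
lemma exists_nat_mul_add_eq_zero {γ c t : ℝ} (hc : c < 0)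
    (h : ∀ n, 0 ≤ ∏ i ∈ Finset.range n, meixnerOffDiag γ c t i) :
    ∃ k : ℕ, (k : ℝ) * c + γ * t = 0 := by
  by_contra! hne
  have hex : ∃ k : ℕ, (k : ℝ) * c + γ * t < 0 := by
    obtain ⟨k, hk⟩ := exists_nat_gt (γ * t / -c)
    rw [div_lt_iff₀ (by linarith)] at hk
    exact ⟨k, by linarith⟩
  classical
  have hneg := Nat.find_spec hex
  have hmin := fun i (hi : i < Nat.find hex) => Nat.find_min hex hi
  have hpos : 0 < ∏ i ∈ Finset.range (Nat.find hex), meixnerOffDiag γ c t i := by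
    refine Finset.prod_pos fun i hi => mul_pos (by positivity) ?_
    exact lt_of_le_of_ne (not_lt.1 (hmin i (Finset.mem_range.1 hi))) (hne i).symm
  have hlast := h (Nat.find hex + 1)
  rw [Finset.prod_range_succ] at hlast
  have : meixnerOffDiag γ c t (Nat.find hex) < 0 := mul_neg_of_pos_of_neg (by positivity) hneg
  linarith [mul_neg_of_pos_of_neg hpos this]

lemma natCast_mem_of_one_mem {T : AddSubsemigroup ℝ} (h : (1 : ℝ) ∈ T) (n : ℕ) (hn : 1 ≤ n) :
    (n : ℝ) ∈ T := by
  induction n, hn using Nat.le_induction with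
  | base => simpa using h
  | succ n _ ih =>
    push_cast
    exact T.add_mem ih h

lemma isMeixnerFamily_of_convolution {T : AddSubsemigroup ℝ} (hT_one : (1 : ℝ) ∈ T)
    {μ : ℝ → Measure ℝ} (hμ_prob : ∀ t ∈ T, IsProbabilityMeasure (μ t))
    (hμ_moments : ∀ t ∈ T, HasFiniteMoments (μ t)) (hconv : IsConvolutionSemigroup T μ)
    {α β γ a b c : ℕ → ℝ}
    (hspec : ∀ t ∈ T, IsSpectralMeasure (μ t) (t • tridiagonal α β γ + tridiagonal a b c)) :
    IsMeixnerFamily T μ := by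
  set P : ℕ → ℝ[X] := fun i => C (β i) * X + C (b i) with hP
  set Q : ℕ → ℝ[X] := fun i => (C (α i) * X + C (a i)) * (C (γ i) * X + C (c i)) with hQ
  have hmom : ∀ t ∈ T, ∀ m : ℕ, ∫ x, x ^ m ∂(μ t) = polyMoment P Q m t := by
    intro t ht m
    rw [(hspec t ht).2 m, smul_tridiagonal_add_tridiagonal, powEntry_tridiagonal_zero, polyMoment]
    simp only [hP, hQ, eval_add, eval_mul, eval_C, eval_X, mul_comm t]
  have hPQ : ConvolvesMoments P Q := by
    intro s t hs ht n
    have hs := natCast_mem_of_one_mem hT_one s hs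
    have ht := natCast_mem_of_one_mem hT_one t ht
    have := hμ_prob s hs
    have := hμ_prob t ht
    rw [← hmom _ (T.add_mem hs ht), hconv _ hs _ ht,
      integral_pow_conv (hμ_moments _ hs) (hμ_moments _ ht)]
    simp only [hmom _ hs, hmom _ ht]
  obtain ⟨β₀, γ₀, b₀, c₀, hγc, hM⟩ := exists_meixner_of_convolvesMoments hPQ
  have hmom' : ∀ t ∈ T, ∀ m : ℕ, ∫ x, x ^ m ∂(μ t) =
      jacobiCoeff (meixnerDiag β₀ b₀ t) (meixnerOffDiag γ₀ c₀ t) m 0 :=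
    fun t ht m => (hmom t ht m).trans (hM m t)
  have hprod : ∀ t ∈ T, ∀ n, 0 ≤ ∏ i ∈ Finset.range n, meixnerOffDiag γ₀ c₀ t i := by
    intro t ht
    have := hμ_prob t ht
    exact prod_nonneg_of_moments_eq (hμ_moments t ht) (hmom' t ht)
  have hγ₀ : 0 ≤ γ₀ := by simpa [meixnerOffDiag] using hprod 1 hT_one 1
  refine ⟨β₀, γ₀, b₀, c₀, hγ₀, ?_, fun t ht => ?_⟩
  · rcases le_or_gt 0 c₀ with hc | hc
    · exact Or.inl hc
    · right
      have hpos : 0 < γ₀ := lt_of_le_of_ne hγ₀ fun h => hc.ne (hγc h.symm)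
      -- Time `1` defines `N` by `N * c₀ + γ₀ = 0`; at time `t` the vanishing index `k` then gives
      -- `t = k / N`.
      obtain ⟨N, hN⟩ := exists_nat_mul_add_eq_zero hc (hprod 1 hT_one)
      have hN0 : N ≠ 0 := by
        rintro rfl
        simp at hN
        exact hpos.ne' hN
      have hN' : (N : ℝ) ≠ 0 := by exact_mod_cast hN0
      refine ⟨N, Nat.one_le_iff_ne_zero.2 hN0, ?_, fun t ht => ?_⟩
      · field_simp
        linarith
      · obtain ⟨k, hk⟩ := exists_nat_mul_add_eq_zero hc (hprod t ht)
        refine ⟨k, ?_⟩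
        rw [eq_div_iff hN']
        refine mul_left_cancel₀ hc.ne ?_
        linear_combination t * hN - hk
  · have := hμ_prob t ht
    exact (hasJacobiParameters_iff (hμ_moments t ht) _ _).2 (hmom' t ht)

lemma convolution_of_isMeixnerFamily {T : AddSubsemigroup ℝ}
    {μ : ℝ → Measure ℝ} (hμ_prob : ∀ t ∈ T, IsProbabilityMeasure (μ t))
    (hμ_moments : ∀ t ∈ T, HasFiniteMoments (μ t)) (h : IsMeixnerFamily T μ) :
    IsConvolutionSemigroup T μ ∧ ∃ α β γ a b c : ℕ → ℝ, ∀ t ∈ T,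
      IsSpectralMeasure (μ t) (t • tridiagonal α β γ + tridiagonal a b c) := by
  obtain ⟨β₀, γ₀, b₀, c₀, -, -, hJ⟩ := h
  have hmom : ∀ t ∈ T, ∀ m : ℕ, ∫ x, x ^ m ∂(μ t) =
      jacobiCoeff (meixnerDiag β₀ b₀ t) (meixnerOffDiag γ₀ c₀ t) m 0 := by
    intro t ht
    have := hμ_prob t ht
    exact (hasJacobiParameters_iff (hμ_moments t ht) _ _).1 (hJ t ht)
  constructor
  · intro s hs t ht
    have hst := T.add_mem hs ht
    have := hμ_prob s hs
    have := hμ_prob t ht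
    have := hμ_prob _ hst
    obtain ⟨A, hA, hbound⟩ := abs_jacobiCoeff_meixner_le β₀ γ₀ b₀ c₀ (s + t)
    refine measure_ext_of_moments (hμ_moments _ hst)
      (hasFiniteMoments_conv (hμ_moments s hs) (hμ_moments t ht)) (fun m => ?_) hA fun m => ?_
    · rw [integral_pow_conv (hμ_moments s hs) (hμ_moments t ht), hmom _ hst,
        jacobiCoeff_meixner_add]
      simp only [hmom s hs, hmom t ht]
    · simpa [hmom _ hst] using hbound m 0
  -- Only products of opposite entries matter, so the subdiagonal is taken to be constantly `1` and
  -- the superdiagonal carries `γ n`, which is affine in `t`.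
  · refine ⟨fun _ => 0, fun _ => β₀, fun n => (n + 1) * γ₀, fun _ => 1, fun n => n * b₀,
      fun n => (n + 1) * (n * c₀), fun t ht => ⟨hμ_moments t ht, fun m => ?_⟩⟩
    rw [hmom t ht, smul_tridiagonal_add_tridiagonal, powEntry_tridiagonal_zero]
    congr 1 <;> funext n <;> simp only [meixnerDiag, meixnerOffDiag] <;> ring

end

theorem mainTheorem8 (T : AddSubsemigroup ℝ) (hT_nonneg : ∀ t ∈ T, 0 ≤ t) (hT_one : (1 : ℝ) ∈ T)
    (μ : ℝ → MeasureTheory.Measure ℝ)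
    (hμ_prob : ∀ t ∈ T, MeasureTheory.IsProbabilityMeasure (μ t))
    (hμ_moments : ∀ t ∈ T, HasFiniteMoments (μ t)) :
    (IsConvolutionSemigroup T μ ∧
      ∃ α β γ a b c : ℕ → ℝ, ∀ t ∈ T,
        IsSpectralMeasure (μ t) (t • tridiagonal α β γ + tridiagonal a b c)) ↔
    IsMeixnerFamily T μ := by
  constructor
  · rintro ⟨hconv, α, β, γ, a, b, c, hspec⟩
    exact isMeixnerFamily_of_convolution hT_one hμ_prob hμ_moments hconv hspec
  · exact convolution_of_isMeixnerFamily hμ_prob hμ_moments
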